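/- Let $A$ be the set of all convex functions $\varphi:[0,\infty)\to[0,\infty)$ with $\lim_{x\to\infty}\varphi(x)/x=\infty$, let $E=L^1[0,1]$ (Lebesgue measure), and let $E^A$ be the product of copies of $E$ indexed by $A$, with coordinatewise order. Let $e\in E^A$ have all coordinates equal to the constant function $1$, and let $T:E^A\to E^A$ be the coordinatewise expectation, $(Tf)(\psi)=\left(\int_0^1 f(\psi)\,d\mu\right)\mathbf 1$ for $\psi\in A$. (a) $(E^A,e,T)$ is a conditional Riesz triple: $E^A$ is a Dedekind complete Riesz space, $e$ is a weak order unit, and $T$ is an order continuous strictly positive projection whose range is a Dedekind complete Riesz subspace, with $Te=e$. Its universal completion is $L^0[0,1]^A$, and it coincides with its natural domain: $L^1(T)=E^A$, where $L^1(T)$ consists of the $u$ in the universal completion such that $|u|$ is the supremum of an upward directed set $D$ of positive elements of $E^A$ with $T(D)$ order bounded in the universal completion. (b) For each $\varphi\in A$ there is $X_\varphi\in L^1[0,1]$ with $\int_{\{|X_\varphi|\ge n\}}|X_\varphi|\,d\mu\to0$ as $n\to\infty$ and $\int\varphi(|X_\varphi|)\,d\mu=\infty$. (c) For every choice of $X_\varphi\in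 L^1[0,1]$ ($\varphi\in A$) with $\int\varphi(|X_\varphi|)\,d\mu=\infty$, define $Y^\varphi\in L^1(T)$ by $Y^\varphi(\varphi)=X_\varphi$ and $Y^\varphi(\psi)=0$ for $\psi\ne\varphi$. Then the family $(Y^\varphi)_{\varphi\in A}$ is $T$-uniform, that is, $\sup_{\varphi\in A}T P_{(|Y^\varphi|-ce)^+}|Y^\varphi|$ exists in $L^1(T)$ for every $c>0$ and converges to $0$ in order as $c\to\infty$, where $P_u$ is the band projection onto the band generated by $u$. However, there is no $\varphi\in A$ for which $\sup_{\chi\in A}T\varphi(|Y^\chi|)$ exists in $L^1(T)$. Here $\varphi(|Y|)$ is formed coordinatewise in $L^0[0,1]^A$, and the assertion holds both when existence is taken to require $\varphi(|Y^\chi|)\in L^1(T)$ for all $\chi$ and when $T\varphi(|Y^\chi|)$ is allowed to be an element of the sup-completion of $L^1(T)$, namely $\sup\{Tx: x\in L^1(T),\ 0\le x\le\varphi(|Y^\chi|)\}$. (d) Hence the implication "$T$-uniform $\Rightarrow$ there is $\varphi\in A$ such that $\sup_{Y}T\varphi(|Y|)$ exists in $L^1(T)$" (the necessity direction of de la Vallée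 Poussin's theorem) fails for families in $L^1(T)$. -/

import Mathlib

open MeasureTheory Filter Topology
open scoped NNReal ENNReal unitInterval

/-! ### Riesz spaces, conditional expectations, natural domains -/

section RieszSpaces

/-- The lattice order of the real vector space `E` makes it a Dedekind complete Riesz space. -/
structure IsDedekindCompleteRieszSpace (E : Type*) [AddCommGroup E] [Lattice E] [Module ℝ E] :
    Prop where
  add_le_add : ∀ x y z : E, x ≤ y → x + z ≤ y + z
  smul_nonneg : ∀ (r : ℝ) (x : E), 0 ≤ r → 0 ≤ x → 0 ≤ r • x
  exists_isLUB : ∀ S : Set E, S.Nonempty → BddAbove S → ∃ s, IsLUB S s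

/-- `e` is a weak order unit: a positive element disjoint from no nonzero element. -/
def IsWeakOrderUnit {E : Type*} [AddCommGroup E] [Lattice E] (e : E) : Prop :=
  0 ≤ e ∧ ∀ x : E, e ⊓ |x| = 0 → x = 0

/-- `T` is a conditional expectation fixing `e`: an order continuous strictly positive projection
whose range is a Dedekind complete Riesz subspace, and `T e = e`. (For a positive operator, order
continuity means that `T` maps every net decreasing to `0` to a net decreasing to `0`.) -/
structure IsConditionalExpectation {E : Type*} [AddCommGroup E] [Lattice E] [Module ℝ E]
    (e : E) (T : E →ₗ[ℝ] E) : Prop where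
  idem : ∀ x, T (T x) = T x
  strictly_positive : ∀ x, 0 < x → 0 < T x
  order_continuous : ∀ D : Set E, D.Nonempty → DirectedOn (· ≥ ·) D → IsGLB D 0 →
    IsGLB (T '' D) 0
  range_sup_mem : ∀ x ∈ Set.range T, ∀ y ∈ Set.range T, x ⊔ y ∈ Set.range T
  range_complete : ∀ S ⊆ Set.range T, S.Nonempty → (upperBounds S ∩ Set.range T).Nonempty →
    ∃ s, IsLeast (upperBounds S ∩ Set.range T) s
  map_unit : T e = e

/-- `(E, e, T)` is a conditional Riesz triple. -/
structure IsConditionalRieszTriple (E : Type*) [AddCommGroup E] [Lattice E] [Module ℝ E]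
    (e : E) (T : E →ₗ[ℝ] E) : Prop where
  complete : IsDedekindCompleteRieszSpace E
  weakUnit : IsWeakOrderUnit e
  condExp : IsConditionalExpectation e T

/-- `U`, with the embedding `ι`, is a universal completion of the Riesz space `E`: it is a Dedekind
complete and laterally complete Riesz space which contains `E` as an order dense Riesz subspace. -/
structure IsUniversalCompletion {E U : Type*} [AddCommGroup E] [Lattice E] [Module ℝ E]
    [AddCommGroup U] [Lattice U] [Module ℝ U] (ι : E →ₗ[ℝ] U) : Prop where
  injective : Function.Injective ι
  map_sup : ∀ x y, ι (x ⊔ y) = ι x ⊔ ι y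
  complete : IsDedekindCompleteRieszSpace U
  laterally_complete : ∀ S : Set U, S.Nonempty → (∀ x ∈ S, 0 ≤ x) →
    (S.Pairwise fun x y => x ⊓ y = 0) → ∃ s, IsLUB S s
  order_dense : ∀ u : U, 0 < u → ∃ x : E, 0 < x ∧ ι x ≤ u

/-- The natural domain `L¹(T)` of `T` inside the universal completion `U`: the elements `u` for
which `|u|` is the supremum of an upward directed set `D` of positive elements of `E` such that
`T D` is order bounded in `U`. -/
def naturalDomain {E U : Type*} [AddCommGroup E] [Lattice E] [Module ℝ E]
    [AddCommGroup U] [Lattice U] [Module ℝ U] (ι : E →ₗ[ℝ] U) (T : E →ₗ[ℝ] E) : Set U :=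
  {u | ∃ D : Set E, D.Nonempty ∧ (∀ x ∈ D, 0 ≤ x) ∧ DirectedOn (· ≤ ·) D ∧
    IsLUB (ι '' D) |u| ∧ BddAbove (ι '' (T '' D))}

/-- The net `s` converges in order to `x` along `l`: there is a net decreasing to `0` (the set `D`)
each of whose members eventually dominates `|s - x|`. -/
def OrderTendsto {κ E : Type*} [AddCommGroup E] [Lattice E] (s : κ → E) (l : Filter κ) (x : E) :
    Prop :=
  ∃ D : Set E, D.Nonempty ∧ DirectedOn (· ≥ ·) D ∧ IsGLB D 0 ∧ ∀ d ∈ D, ∀ᶠ c in l, |s c - x| ≤ d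

/-- For `u, v ≥ 0`, `w` is `P_u v`, the image of `v` under the band projection onto the band
generated by `u`, that is `w = sup_n (v ∧ n u)`. -/
def IsBandProj {E : Type*} [AddCommGroup E] [Lattice E] (u v w : E) : Prop :=
  IsLUB (Set.range fun n : ℕ => v ⊓ n • u) w

/-- The family `Y` is `T`-uniform: `sup_i T P_{(|Y i| - c e)⁺} |Y i|` exists for all `c > 0` and
converges in order to `0` as `c → ∞`. -/
def IsTUniform {κ E : Type*} [AddCommGroup E] [Lattice E] [Module ℝ E] (e : E) (T : E →ₗ[ℝ] E)
    (Y : κ → E) : Prop :=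
  ∃ s : ℝ → E,
    (∀ c > 0, IsLUB {y | ∃ i w, IsBandProj ((|Y i| - c • e) ⊔ 0) |Y i| w ∧ y = T w} (s c)) ∧
    OrderTendsto s atTop 0

/-- `Z` is a family of elements of the natural domain `E` of `T` (seen in `U`) and
`sup_i T (Z i)` exists in `E`. -/
def HasSupInNaturalDomain {κ E U : Type*} [AddCommGroup E] [Lattice E] [Module ℝ E]
    [AddCommGroup U] [Lattice U] [Module ℝ U] (ι : E →ₗ[ℝ] U) (T : E →ₗ[ℝ] E) (Z : κ → U) : Prop :=
  ∃ W : κ → E, (∀ i, ι (W i) = Z i) ∧ ∃ s : E, IsLUB (Set.range fun i => T (W i)) s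

/-- For a family `Z` of positive elements of `U`, with `T (Z i) = sup {T x | 0 ≤ x ≤ Z i, x ∈ E}`
taken in the sup-completion `E^s`: the supremum `sup_i T (Z i)`, computed in `E^s`, belongs
to `E`. -/
def HasFiniteSup {κ E U : Type*} [AddCommGroup E] [Lattice E] [Module ℝ E]
    [AddCommGroup U] [Lattice U] [Module ℝ U] (ι : E →ₗ[ℝ] U) (T : E →ₗ[ℝ] E) (Z : κ → U) : Prop :=
  ∃ s : E, IsLUB {y | ∃ i x, 0 ≤ x ∧ ι x ≤ Z i ∧ y = T x} s

end RieszSpaces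

/-! ### The product of copies of `L¹[0,1]` indexed by the test functions -/

noncomputable section

/-- The test functions: convex `φ : [0,∞) → [0,∞)` with `φ(x)/x → ∞` as `x → ∞`. -/
def ConvexTestFunction : Type :=
  {φ : ℝ≥0 → ℝ≥0 // ConvexOn ℝ≥0 Set.univ φ ∧ Tendsto (fun x => φ x / x) atTop atTop}

instance : CoeFun ConvexTestFunction fun _ => ℝ≥0 → ℝ≥0 := ⟨Subtype.val⟩

theorem ConvexTestFunction.measurable (φ : ConvexTestFunction) : Measurable (φ : ℝ≥0 → ℝ≥0) := by
  refine measurable_of_Iic fun c => Set.OrdConnected.measurableSet ?_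
  have h := φ.2.1.convex_le c
  refine ⟨fun x hx y hy z hz => ?_⟩
  have h2 := h.segment_subset (x := x) (y := y) ⟨trivial, hx⟩ ⟨trivial, hy⟩
    (NNReal.Icc_subset_segment hz)
  exact h2.2

/-- `L¹[0,1]` with Lebesgue measure. -/
abbrev L1 : Type := Lp ℝ 1 (volume : Measure I)

/-- `L⁰[0,1]`: classes of measurable real functions modulo equality almost everywhere. -/
abbrev L0 : Type := I →ₘ[(volume : Measure I)] ℝ

/-- The product space `E^A`, with `E = L¹[0,1]` and `A` the set of test functions. -/
abbrev ProdL1 : Type := ConvexTestFunction → L1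

/-- `L⁰[0,1]^A`. -/
abbrev ProdL0 : Type := ConvexTestFunction → L0

/-- The coordinatewise inclusion of `L¹[0,1]^A` in `L⁰[0,1]^A`. -/
def prodIncl : ProdL1 →ₗ[ℝ] ProdL0 where
  toFun f ψ := (f ψ : L0)
  map_add' _ _ := rfl
  map_smul' _ _ := rfl

/-- The unit `e`: every coordinate is the constant function `1`. -/
def prodUnit : ProdL1 := fun _ => Lp.const 1 volume 1

/-- The coordinatewise expectation: the `ψ`-th coordinate of `T f` is the constant `∫ f ψ`. -/
def prodExp : ProdL1 →ₗ[ℝ] ProdL1 where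
  toFun f ψ := Lp.const 1 volume (∫ t, f ψ t)
  map_add' f g := by
    funext ψ
    rw [Pi.add_apply, Pi.add_apply, ← map_add,
      ← integral_add (L1.integrable_coeFn (f ψ)) (L1.integrable_coeFn (g ψ))]
    exact congrArg _ (integral_congr_ae (Lp.coeFn_add (f ψ) (g ψ)))
  map_smul' r f := by
    funext ψ
    have h : ∫ t, (r • f ψ) t = r • ∫ t, f ψ t := by
      rw [← integral_smul]
      exact integral_congr_ae (Lp.coeFn_smul r (f ψ))
    change Lp.const 1 (volume : Measure I) (∫ t, (r • f ψ) t) =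
      r • Lp.const 1 (volume : Measure I) (∫ t, f ψ t)
    rw [h]
    exact map_smul (Lp.constₗ 1 (volume : Measure I) ℝ) r _

/-- `φ(|z|)` for `z ∈ L⁰[0,1]^A`: coordinatewise composition with `φ`. -/
def ConvexTestFunction.compAbs (φ : ConvexTestFunction) (z : ProdL0) : ProdL0 := fun ψ =>
  (z ψ).compMeasurable (fun r : ℝ => (φ ‖r‖₊ : ℝ))
    (measurable_coe_nnreal_real.comp (φ.measurable.comp measurable_nnnorm))

open Classical in
/-- The element `Y^φ` of `E^A` with `Y^φ(φ) = X φ` and `Y^φ(ψ) = 0` for `ψ ≠ φ`. -/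
def spikeFamily (X : ConvexTestFunction → L1) (φ : ConvexTestFunction) : ProdL1 :=
  fun ψ => if ψ = φ then X φ else 0

end

/-! ### Suprema in `L⁰` and `L¹` of a finite measure, reduced to sequences -/

section CountableSup

variable {α : Type*} [MeasurableSpace α] {μ : Measure α}

/-! In `E^A` suprema, band projections and `T` are all computed coordinatewise, and order
convergence to `0` demands no uniformity across coordinates. The family `Y^φ` has only `X ψ` in
coordinate `ψ`, so `T`-uniformity asks only that each single integrable `X ψ` have vanishing tails,
which is automatic (`isTUniform_spikeFamily`). A test function, on the other hand, must serve all
coordinates at once, and the diagonal choice defeats it: coordinate `φ` contains a function with `∫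
φ(|X φ|) = ∞`. Such a function exists because `φ` grows superlinearly
(`exists_L1_lintegral_eq_top`). Allowing values in the sup-completion does not help, since by Fatou
a bound on the expectations of truncations would make `φ(|X φ|)` integrable
(`not_hasFiniteSup_spikeFamily`).

The structural claims rest on the countable sup property `exists_seq_mem_upperBounds`: arbitrary
suprema become suprema of sequences, which can be taken pointwise, and directed sets become monotone
sequences, to which monotone convergence and Fatou apply. -/

theorem integrable_arctan_comp [IsFiniteMeasure μ] (f : α →ₘ[μ] ℝ) :
    Integrable (fun t => Real.arctan (f t)) μ := by
  refine Integrable.of_bound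
    (Real.continuous_arctan.comp_aestronglyMeasurable f.aestronglyMeasurable) (Real.pi / 2)
    (Eventually.of_forall fun t => ?_)
  rw [Real.norm_eq_abs, abs_le]
  exact ⟨(Real.neg_pi_div_two_lt_arctan _).le, (Real.arctan_lt_pi_div_two _).le⟩

/-- The countable sup property of `L⁰`. -/
theorem exists_seq_mem_upperBounds [IsFiniteMeasure μ] {S : Set (α →ₘ[μ] ℝ)} (hS : S.Nonempty) :
    ∃ f : ℕ → α →ₘ[μ] ℝ, (∀ n, f n ∈ S) ∧ ∀ b, (∀ n, f n ≤ b) → b ∈ upperBounds S := by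
  -- Exhaustion: `J` is bounded because `arctan` is, and strictly increasing. A maximizing sequence
  -- is taken among finite suprema of members of `S`; the members occurring in these suprema form
  -- the required countable family.
  let J : (α →ₘ[μ] ℝ) → ℝ := fun f => ∫ t, Real.arctan (f t) ∂μ
  have hne : (J '' supClosure S).Nonempty := (hS.mono subset_supClosure).image J
  have hbdd : BddAbove (J '' supClosure S) := by
    refine ⟨∫ _, Real.pi / 2 ∂μ, ?_⟩
    rintro _ ⟨f, -, rfl⟩
    exact integral_mono (integrable_arctan_comp f) (integrable_const _)
      fun t => (Real.arctan_lt_pi_div_two _).le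
  obtain ⟨u, -, hu, hmem⟩ := exists_seq_tendsto_sSup hne hbdd
  choose g hg hgu using hmem
  choose F hF hFS hFg using hg
  have hC : (⋃ n, (F n : Set (α →ₘ[μ] ℝ))).Countable :=
    Set.countable_iUnion fun n => (F n).countable_toSet
  have hCne : (⋃ n, (F n : Set (α →ₘ[μ] ℝ))).Nonempty := by
    obtain ⟨x, hx⟩ := hF 0
    exact ⟨x, Set.mem_iUnion.2 ⟨0, hx⟩⟩
  obtain ⟨f, hf⟩ := hC.exists_eq_range hCne
  refine ⟨f, fun n => ?_, fun b hb s hs => ?_⟩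
  · have : f n ∈ ⋃ n, (F n : Set (α →ₘ[μ] ℝ)) := hf ▸ Set.mem_range_self n
    obtain ⟨m, hm⟩ := Set.mem_iUnion.1 this
    exact hFS m hm
  have hgb : ∀ n, g n ≤ b := by
    intro n
    rw [← hFg n]
    refine Finset.sup'_le _ _ fun x hx => ?_
    have : x ∈ Set.range f := hf ▸ Set.mem_iUnion.2 ⟨n, hx⟩
    obtain ⟨m, rfl⟩ := this
    exact hb m
  have hgS : ∀ n, g n ∈ supClosure S := fun n => ⟨F n, hF n, hFS n, hFg n⟩
  have hint : Integrable (fun t => max (Real.arctan (s t) - Real.arctan (b t)) 0) μ :=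
    ((integrable_arctan_comp s).sub (integrable_arctan_comp b)).pos_part
  -- Joining `s` to `g n` stays in the sup-closure, so it can raise `J` by at most the distance of
  -- `J (g n)` from the supremum. As `g n ≤ b`, the excess of `s` over `b` is at most this gain.
  have hle : ∀ n, ∫ t, max (Real.arctan (s t) - Real.arctan (b t)) 0 ∂μ ≤
      sSup (J '' supClosure S) - u n := by
    intro n
    have h1 : ∫ t, max (Real.arctan (s t) - Real.arctan (b t)) 0 ∂μ ≤
        ∫ t, (Real.arctan ((g n ⊔ s : α →ₘ[μ] ℝ) t) - Real.arctan (g n t)) ∂μ := by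
      refine integral_mono_ae hint
        ((integrable_arctan_comp _).sub (integrable_arctan_comp _)) ?_
      filter_upwards [AEEqFun.coeFn_le.2 (hgb n), AEEqFun.coeFn_sup (g n) s] with t h1 h2
      simp only [h2]
      have h3 := Real.arctan_strictMono.monotone h1
      have h4 := Real.arctan_strictMono.monotone (le_max_left (g n t) (s t))
      have h5 := Real.arctan_strictMono.monotone (le_max_right (g n t) (s t))
      exact max_le (by linarith) (by linarith)
    rw [integral_sub (integrable_arctan_comp _) (integrable_arctan_comp _)] at h1
    have h2 : J (g n ⊔ s) ≤ sSup (J '' supClosure S) :=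
      le_csSup hbdd ⟨_, supClosed_supClosure (hgS n) (subset_supClosure hs), rfl⟩
    have h3 : J (g n) = u n := hgu n
    simp only [J] at h2 h3
    linarith
  have h0 : ∫ t, max (Real.arctan (s t) - Real.arctan (b t)) 0 ∂μ = 0 := by
    refine le_antisymm ?_ (integral_nonneg fun t => le_max_right _ _)
    refine ge_of_tendsto' (x := atTop) (f := fun n => sSup (J '' supClosure S) - u n) ?_ hle
    simpa using (tendsto_const_nhds (x := sSup (J '' supClosure S))).sub hu
  replace h0 := (integral_eq_zero_iff_of_nonneg
    (f := fun t => max (Real.arctan (s t) - Real.arctan (b t)) 0)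
    (fun t => le_max_right _ _) hint).1 h0
  rw [← AEEqFun.coeFn_le]
  filter_upwards [h0] with t ht
  have h1 : Real.arctan (s t) - Real.arctan (b t) ≤ 0 := by
    have : max (Real.arctan (s t) - Real.arctan (b t)) 0 = 0 := ht
    exact max_eq_right_iff.1 this
  exact Real.arctan_strictMono.le_iff_le.1 (by linarith)

/-- For a sequence, the pointwise supremum is measurable and the exceptional null sets can be
merged. -/
theorem exists_isLUB_range_of_ae_bddAbove (f : ℕ → α →ₘ[μ] ℝ)
    (hf : ∀ᵐ t ∂μ, BddAbove (Set.range fun n => f n t)) :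
    ∃ g : α →ₘ[μ] ℝ, IsLUB (Set.range f) g ∧ ∀ᵐ t ∂μ, g t = ⨆ n, f n t := by
  have hm : Measurable fun t => ⨆ n, f n t := Measurable.iSup fun n => (f n).measurable
  have hg := AEEqFun.coeFn_mk (μ := μ) _ hm.aestronglyMeasurable
  refine ⟨AEEqFun.mk _ hm.aestronglyMeasurable, ⟨?_, fun b hb => ?_⟩, hg⟩
  · rintro _ ⟨n, rfl⟩
    rw [← AEEqFun.coeFn_le]
    filter_upwards [hf, hg] with t h1 h2
    rw [h2]
    exact le_ciSup h1 n
  · rw [← AEEqFun.coeFn_le]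
    have : ∀ᵐ t ∂μ, ∀ n, f n t ≤ b t :=
      ae_all_iff.2 fun n => AEEqFun.coeFn_le.2 (hb ⟨n, rfl⟩)
    filter_upwards [this, hg] with t h1 h2
    rw [h2]
    exact ciSup_le h1

theorem exists_isLUB_L0 [IsFiniteMeasure μ] {S : Set (α →ₘ[μ] ℝ)} (hS : S.Nonempty)
    (hb : BddAbove S) : ∃ s, IsLUB S s := by
  obtain ⟨f, hfS, hf⟩ := exists_seq_mem_upperBounds hS
  obtain ⟨b, hb⟩ := hb
  have : ∀ᵐ t ∂μ, ∀ n, f n t ≤ b t :=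
    ae_all_iff.2 fun n => AEEqFun.coeFn_le.2 (hb (hfS n))
  obtain ⟨g, hg, -⟩ := exists_isLUB_range_of_ae_bddAbove f <| by
    filter_upwards [this] with t ht
    exact ⟨b t, by rintro _ ⟨n, rfl⟩; exact ht n⟩
  refine ⟨g, hf g fun n => hg.1 ⟨n, rfl⟩, fun c hc => hg.2 ?_⟩
  rintro _ ⟨n, rfl⟩
  exact hc (hfS n)

/-- At almost every point at most one of the distinct members of the extracted sequence is nonzero,
so the sequence is pointwise bounded although no common upper bound is given. -/
theorem exists_isLUB_L0_of_pairwise_disjoint [IsFiniteMeasure μ] {S : Set (α →ₘ[μ] ℝ)}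
    (hS : S.Nonempty) (hpos : ∀ x ∈ S, 0 ≤ x) (hd : S.Pairwise fun x y => x ⊓ y = 0) :
    ∃ s, IsLUB S s := by
  obtain ⟨f, hfS, hf⟩ := exists_seq_mem_upperBounds hS
  have h0 : ∀ᵐ t ∂μ, ∀ n, 0 ≤ f n t := ae_all_iff.2 fun n => by
    filter_upwards [AEEqFun.coeFn_le.2 (hpos _ (hfS n)), AEEqFun.coeFn_zero (α := α) (β := ℝ)]
      with t h1 h2
    rw [h2] at h1
    exact h1
  have h1 : ∀ᵐ t ∂μ, ∀ n m, f n = f m ∨ min (f n t) (f m t) = 0 :=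
    ae_all_iff.2 fun n => ae_all_iff.2 fun m => by
      by_cases h : f n = f m
      · exact Eventually.of_forall fun _ => Or.inl h
      · have h2 := AEEqFun.coeFn_inf (f n) (f m)
        rw [hd (hfS n) (hfS m) h] at h2
        filter_upwards [h2, AEEqFun.coeFn_zero (α := α) (β := ℝ)] with t h3 h4
        rw [h4] at h3
        exact Or.inr h3.symm
  obtain ⟨g, hg, -⟩ := exists_isLUB_range_of_ae_bddAbove f <| by
    filter_upwards [h0, h1] with t h2 h3
    by_cases h : ∃ n, 0 < f n t
    · obtain ⟨n, hn⟩ := h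
      refine ⟨f n t, ?_⟩
      rintro _ ⟨m, rfl⟩
      rcases h3 n m with h4 | h4
      · simp only [h4, le_refl]
      · rcases min_choice (f n t) (f m t) with h5 | h5
        · rw [h5] at h4; exact absurd h4 hn.ne'
        · rw [h5] at h4; simp only [h4]; exact hn.le
    · push Not at h
      exact ⟨0, by rintro _ ⟨m, rfl⟩; exact h m⟩
  refine ⟨g, hf g fun n => hg.1 ⟨n, rfl⟩, fun c hc => hg.2 ?_⟩
  rintro _ ⟨n, rfl⟩
  exact hc (hfS n)

/-- The supremum in `L⁰` lies between a member and an upper bound, both integrable, hence is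
integrable. -/
theorem exists_isLUB_Lp_one [IsFiniteMeasure μ] {S : Set (Lp ℝ 1 μ)} (hS : S.Nonempty)
    (hb : BddAbove S) : ∃ s, IsLUB S s := by
  obtain ⟨x, hx⟩ := hS
  obtain ⟨b, hb⟩ := hb
  obtain ⟨s, hs⟩ := exists_isLUB_L0 (S := (Subtype.val : Lp ℝ 1 μ → α →ₘ[μ] ℝ) '' S)
    ⟨_, x, hx, rfl⟩ ⟨b, by rintro _ ⟨y, hy, rfl⟩; exact hb hy⟩
  have h1 : (x : α →ₘ[μ] ℝ) ≤ s := hs.1 ⟨x, hx, rfl⟩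
  have h2 : s ≤ b := hs.2 (by rintro _ ⟨y, hy, rfl⟩; exact hb hy)
  have hint : Integrable s μ :=
    integrable_of_le_of_le s.aestronglyMeasurable (AEEqFun.coeFn_le.2 h1)
      (AEEqFun.coeFn_le.2 h2) (L1.integrable_coeFn x) (L1.integrable_coeFn b)
  have hmem : s ∈ Lp ℝ 1 μ := Lp.mem_Lp_iff_memLp.2 (memLp_one_iff_integrable.2 hint)
  refine ⟨⟨s, hmem⟩, fun y hy => hs.1 ⟨y, hy, rfl⟩, fun c hc => ?_⟩
  have : s ≤ c := hs.2 (by rintro _ ⟨y, hy, rfl⟩; exact hc hy)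
  exact this

/-- A directed set in `L¹` contains an increasing sequence with the same upper bounds. -/
theorem exists_monotone_seq_mem_upperBounds [IsFiniteMeasure μ] {S : Set (Lp ℝ 1 μ)}
    (hS : S.Nonempty) (hd : DirectedOn (· ≤ ·) S) :
    ∃ g : ℕ → Lp ℝ 1 μ, Monotone g ∧ (∀ n, g n ∈ S) ∧
      ∀ b : α →ₘ[μ] ℝ, (∀ n, (g n : α →ₘ[μ] ℝ) ≤ b) → ∀ x ∈ S, (x : α →ₘ[μ] ℝ) ≤ b := by
  obtain ⟨f, hfS, hf⟩ := exists_seq_mem_upperBounds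
    (hS.image (Subtype.val : Lp ℝ 1 μ → α →ₘ[μ] ℝ))
  choose h hhS hhf using hfS
  choose up hupS hup₁ hup₂ using hd
  let G : ℕ → S := fun n => Nat.rec ⟨h 0, hhS 0⟩
    (fun n x => ⟨up x x.2 (h (n + 1)) (hhS (n + 1)), hupS _ _ _ _⟩) n
  have hG : ∀ n, h n ≤ (G n).1 := by
    rintro (_ | n)
    · exact le_rfl
    · exact hup₂ _ _ _ _
  refine ⟨fun n => (G n).1, monotone_nat_of_le_succ fun n => hup₁ _ _ _ _, fun n => (G n).2, ?_⟩
  intro b hb x hx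
  refine hf b (fun n => ?_) ⟨x, hx, rfl⟩
  rw [← hhf n]
  exact le_trans (hG n) (hb n)

/-- Order continuity of the integral: a decreasing sequence extracted from `D` already has infimum
`0`, hence tends to `0` almost everywhere, and monotone convergence applies. The proof works with
`-D`, which is directed upward. -/
theorem exists_seq_integral_tendsto_zero [IsFiniteMeasure μ] {D : Set (Lp ℝ 1 μ)}
    (hD : D.Nonempty) (hd : DirectedOn (· ≥ ·) D) (h0 : IsGLB D 0) :
    ∃ g : ℕ → Lp ℝ 1 μ, (∀ n, g n ∈ D) ∧ Tendsto (fun n => ∫ t, g n t ∂μ) atTop (𝓝 0) := by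
  obtain ⟨g, hg, hgD, hgb⟩ := exists_monotone_seq_mem_upperBounds (S := {x | -x ∈ D})
    (by obtain ⟨x, hx⟩ := hD; exact ⟨-x, by simpa using hx⟩)
    (by
      intro x hx y hy
      obtain ⟨z, hz, h1, h2⟩ := hd _ hx _ hy
      exact ⟨-z, by simpa using hz, le_neg.2 h1, le_neg.2 h2⟩)
  have hmono : ∀ᵐ t ∂μ, Monotone fun n => g n t := by
    have : ∀ᵐ t ∂μ, ∀ n, g n t ≤ g (n + 1) t :=
      ae_all_iff.2 fun n => (Lp.coeFn_le _ _).2 (hg n.le_succ)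
    filter_upwards [this] with t ht
    exact monotone_nat_of_le_succ ht
  have hneg : ∀ᵐ t ∂μ, ∀ n, g n t ≤ 0 := ae_all_iff.2 fun n => by
    have h1 : g n ≤ 0 := by simpa using h0.1 (hgD n)
    filter_upwards [(Lp.coeFn_le _ _).2 h1, Lp.coeFn_zero ℝ 1 μ] with t h2 h3
    rw [h3] at h2
    exact h2
  obtain ⟨s, hs, hst⟩ := exists_isLUB_range_of_ae_bddAbove (fun n => (g n : α →ₘ[μ] ℝ)) <| by
    filter_upwards [hneg] with t ht
    exact ⟨0, by rintro _ ⟨n, rfl⟩; exact ht n⟩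
  have hs0 : s ≤ ((0 : Lp ℝ 1 μ) : α →ₘ[μ] ℝ) := hs.2 <| by
    rintro _ ⟨n, rfl⟩
    change g n ≤ 0
    simpa using h0.1 (hgD n)
  have hint : Integrable s μ :=
    integrable_of_le_of_le s.aestronglyMeasurable (AEEqFun.coeFn_le.2 (hs.1 ⟨0, rfl⟩))
      (AEEqFun.coeFn_le.2 hs0) (L1.integrable_coeFn (g 0)) (L1.integrable_coeFn 0)
  let s' : Lp ℝ 1 μ := ⟨s, Lp.mem_Lp_iff_memLp.2 (memLp_one_iff_integrable.2 hint)⟩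
  have hs1 : (0 : Lp ℝ 1 μ) ≤ s' := by
    have : -s' ≤ 0 := h0.2 fun x hx => by
      have h1 : -x ≤ s' := hgb s (fun n => hs.1 ⟨n, rfl⟩) (-x) (by simpa using hx)
      exact neg_le.1 h1
    simpa using this
  have hlim : ∀ᵐ t ∂μ, Tendsto (fun n => g n t) atTop (𝓝 0) := by
    filter_upwards [hmono, hneg, hst, (Lp.coeFn_le _ _).2 hs1, Lp.coeFn_zero ℝ 1 μ]
      with t h1 h2 h3 h4 h5
    have hb : BddAbove (Set.range fun n => g n t) := ⟨0, by rintro _ ⟨n, rfl⟩; exact h2 n⟩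
    have h6 : ⨆ n, g n t = 0 := by
      refine le_antisymm (ciSup_le h2) ?_
      rw [← h3]
      rw [h5] at h4
      exact h4
    exact h6 ▸ tendsto_atTop_ciSup h1 hb
  refine ⟨fun n => -g n, hgD, ?_⟩
  have h1 := integral_tendsto_of_tendsto_of_monotone (F := fun _ => (0 : ℝ))
    (fun n => L1.integrable_coeFn (g n)) (integrable_zero _ _ _) hmono hlim
  have h2 := h1.neg
  simp only [integral_zero, neg_zero] at h2
  refine h2.congr fun n => ?_
  rw [← integral_neg]
  refine integral_congr_ae ?_
  filter_upwards [Lp.coeFn_neg (g n)] with t ht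
  rw [ht]
  rfl

end CountableSup

/-! ### The conditional Riesz triple on `L¹[0,1]^A` -/

section ConditionalRieszTriple

theorem prodExp_apply (f : ProdL1) (ψ : ConvexTestFunction) :
    prodExp f ψ = Lp.const 1 volume (∫ t, f ψ t) := rfl

theorem prodIncl_apply (f : ProdL1) (ψ : ConvexTestFunction) : prodIncl f ψ = (f ψ : L0) := rfl

theorem const_le_const_iff {a b : ℝ} :
    Lp.const 1 (volume : Measure I) a ≤ Lp.const 1 volume b ↔ a ≤ b := by
  rw [← Lp.coeFn_le]
  constructor
  · intro h
    obtain ⟨t, h1, h2, h3⟩ := (h.and ((Lp.coeFn_const 1 volume a).and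
      (Lp.coeFn_const 1 volume b))).exists
    rw [h2, h3] at h1
    exact h1
  · intro h
    filter_upwards [Lp.coeFn_const 1 (volume : Measure I) a,
      Lp.coeFn_const 1 (volume : Measure I) b] with t h2 h3
    rw [h2, h3]
    exact h

theorem integral_const_L1 (a : ℝ) : ∫ t, Lp.const 1 (volume : Measure I) a t = a := by
  rw [integral_congr_ae (Lp.coeFn_const 1 volume a)]
  simp

/-- Constants embed continuously in `L¹`, whose order is closed. -/
theorem le_zero_of_le_const_of_tendsto {b : L1} {r : ℕ → ℝ}
    (h : ∀ n, b ≤ Lp.const 1 volume (r n)) (hr : Tendsto r atTop (𝓝 0)) : b ≤ 0 := by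
  have h1 : Tendsto (fun n => Lp.const 1 (volume : Measure I) (r n)) atTop (𝓝 0) := by
    have := ((Lp.constL 1 (volume : Measure I) ℝ (E := ℝ)).continuous.tendsto 0).comp hr
    rwa [map_zero] at this
  exact ge_of_tendsto' h1 h

theorem integral_L1_mono {x y : L1} (h : x ≤ y) : ∫ t, x t ≤ ∫ t, y t :=
  integral_mono_ae (L1.integrable_coeFn x) (L1.integrable_coeFn y) ((Lp.coeFn_le x y).2 h)

theorem integral_L1_zero : ∫ t, (0 : L1) t = 0 := by
  rw [integral_congr_ae (Lp.coeFn_zero ℝ 1 (volume : Measure I))]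
  simp

theorem eq_zero_of_integral_eq_zero {x : L1} (h : 0 ≤ x) (h0 : ∫ t, x t = 0) : x = 0 := by
  have h1 := (integral_eq_zero_iff_of_nonneg_ae ((Lp.coeFn_nonneg x).2 h)
    (L1.integrable_coeFn x)).1 h0
  exact (Lp.eq_zero_iff_ae_eq_zero).2 h1

theorem prodExp_nonneg {x : ProdL1} (h : 0 ≤ x) : 0 ≤ prodExp x := by
  intro ψ
  have h1 := integral_L1_mono (h ψ)
  rw [Pi.zero_apply, integral_L1_zero] at h1
  have h2 := const_le_const_iff.2 h1
  rwa [map_zero] at h2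

theorem exists_isLUB_pi {ι : Type*} {E : ι → Type*} [∀ i, Preorder (E i)]
    (h : ∀ i, ∀ S : Set (E i), S.Nonempty → BddAbove S → ∃ s, IsLUB S s)
    (S : Set (∀ i, E i)) (hS : S.Nonempty) (hb : BddAbove S) : ∃ s, IsLUB S s := by
  choose s hs using fun i => h i (Function.eval i '' S) (hS.image _)
    ((Function.monotone_eval i).map_bddAbove hb)
  exact ⟨s, isLUB_pi.2 hs⟩

theorem smul_nonneg_L0 (r : ℝ) (x : L0) (hr : 0 ≤ r) (hx : 0 ≤ x) : 0 ≤ r • x := by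
  rw [← AEEqFun.coeFn_le] at hx ⊢
  filter_upwards [hx, AEEqFun.coeFn_zero (α := I) (β := ℝ) (μ := volume), AEEqFun.coeFn_smul r x]
    with t h1 h2 h3
  rw [h2] at h1 ⊢
  rw [h3]
  exact mul_nonneg hr h1

theorem add_le_add_L0 (x y z : L0) (h : x ≤ y) : x + z ≤ y + z := by
  rw [← AEEqFun.coeFn_le] at h ⊢
  filter_upwards [h, AEEqFun.coeFn_add x z, AEEqFun.coeFn_add y z] with t h1 h2 h3
  rw [h2, h3]
  exact add_le_add_left h1 _

theorem isDedekindCompleteRieszSpace_prodL1 : IsDedekindCompleteRieszSpace ProdL1 where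
  add_le_add _ _ z h := add_le_add_left h z
  smul_nonneg r x hr hx ψ := smul_nonneg_L0 r (x ψ) hr (hx ψ)
  exists_isLUB := exists_isLUB_pi fun _ _ => exists_isLUB_Lp_one

theorem isDedekindCompleteRieszSpace_prodL0 : IsDedekindCompleteRieszSpace ProdL0 where
  add_le_add x y z h ψ := add_le_add_L0 (x ψ) (y ψ) (z ψ) (h ψ)
  smul_nonneg r x hr hx ψ := smul_nonneg_L0 r (x ψ) hr (hx ψ)
  exists_isLUB := exists_isLUB_pi fun _ _ => exists_isLUB_L0

theorem isWeakOrderUnit_prodUnit : IsWeakOrderUnit prodUnit := by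
  constructor
  · intro ψ
    have := const_le_const_iff.2 (zero_le_one (α := ℝ))
    rwa [map_zero] at this
  · intro x hx
    funext ψ
    have h : Lp.const 1 (volume : Measure I) (1 : ℝ) ⊓ |x ψ| = 0 := congrFun hx ψ
    refine (Lp.eq_zero_iff_ae_eq_zero).2 ?_
    have h1 := Lp.coeFn_inf (Lp.const 1 (volume : Measure I) (1 : ℝ)) |x ψ|
    rw [h] at h1
    filter_upwards [h1, Lp.coeFn_zero ℝ 1 (volume : Measure I), Lp.coeFn_abs (x ψ),
      Lp.coeFn_const 1 (volume : Measure I) (1 : ℝ)] with t h2 h3 h4 h5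
    rw [h3, Pi.inf_apply, h4, h5] at h2
    have h6 : (0 : ℝ) = min 1 |x ψ t| := h2
    rcases min_choice 1 |x ψ t| with h7 | h7
    · rw [h7] at h6; norm_num at h6
    · rw [h7] at h6; exact abs_eq_zero.1 h6.symm

/-- Identifies the range with `ℝ^A`, from which its lattice structure and completeness are
inherited. -/
theorem mem_range_prodExp_iff {x : ProdL1} :
    x ∈ Set.range prodExp ↔ ∃ a : ConvexTestFunction → ℝ, x = fun ψ => Lp.const 1 volume (a ψ) := by
  constructor
  · rintro ⟨y, rfl⟩
    exact ⟨fun ψ => ∫ t, y ψ t, rfl⟩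
  · rintro ⟨a, rfl⟩
    refine ⟨fun ψ => Lp.const 1 volume (a ψ), ?_⟩
    funext ψ
    rw [prodExp_apply, integral_const_L1]

theorem isConditionalExpectation_prodExp : IsConditionalExpectation prodUnit prodExp where
  idem x := by
    funext ψ
    rw [prodExp_apply, prodExp_apply, integral_const_L1]
  strictly_positive x hx := by
    refine lt_of_le_of_ne (prodExp_nonneg hx.le) fun h => hx.ne' ?_
    funext ψ
    refine eq_zero_of_integral_eq_zero (hx.le ψ) ?_
    have h1 := congrArg (fun z : L1 => ∫ t, z t) (congrFun h ψ)
    simp only [prodExp_apply, integral_const_L1] at h1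
    rw [← h1]
    exact integral_L1_zero
  order_continuous D hD hd h0 := by
    refine ⟨?_, fun b hb ψ => ?_⟩
    · rintro _ ⟨x, hx, rfl⟩
      exact prodExp_nonneg (h0.1 hx)
    · obtain ⟨g, hg, hlim⟩ := exists_seq_integral_tendsto_zero (hD.image (Function.eval ψ))
        (by
          rintro _ ⟨x, hx, rfl⟩ _ ⟨y, hy, rfl⟩
          obtain ⟨z, hz, h1, h2⟩ := hd x hx y hy
          exact ⟨_, ⟨z, hz, rfl⟩, h1 ψ, h2 ψ⟩) (isGLB_pi.1 h0 ψ)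
      refine le_zero_of_le_const_of_tendsto (fun n => ?_) hlim
      obtain ⟨x, hx, hxg⟩ := hg n
      rw [← hxg]
      exact hb ⟨x, hx, rfl⟩ ψ
  range_sup_mem x hx y hy := by
    rw [mem_range_prodExp_iff] at hx hy ⊢
    obtain ⟨a, rfl⟩ := hx
    obtain ⟨b, rfl⟩ := hy
    refine ⟨a ⊔ b, ?_⟩
    funext ψ
    change Lp.const 1 (volume : Measure I) (a ψ) ⊔ Lp.const 1 volume (b ψ) =
      Lp.const 1 volume (max (a ψ) (b ψ))
    rcases le_total (a ψ) (b ψ) with h | h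
    · rw [max_eq_right h, sup_eq_right.2 (const_le_const_iff.2 h)]
    · rw [max_eq_left h, sup_eq_left.2 (const_le_const_iff.2 h)]
  range_complete S hS hne hb := by
    let K : (ConvexTestFunction → ℝ) → ProdL1 := fun a ψ => Lp.const 1 volume (a ψ)
    have hK : ∀ {a b}, K a ≤ K b ↔ a ≤ b := fun {a b} =>
      forall_congr' fun ψ => const_le_const_iff
    obtain ⟨b, hb, hbr⟩ := hb
    obtain ⟨b', rfl⟩ := mem_range_prodExp_iff.1 hbr
    obtain ⟨x, hx⟩ := hne
    obtain ⟨x', hx'⟩ := mem_range_prodExp_iff.1 (hS hx)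
    obtain ⟨s, hs⟩ := exists_isLUB_pi
      (fun _ _ h1 h2 => ⟨_, isLUB_csSup h1 h2⟩) (K ⁻¹' S) ⟨x', by rwa [hx'] at hx⟩
      ⟨b', fun a ha => hK.1 (hb ha)⟩
    refine ⟨K s, ⟨fun y hy => ?_, mem_range_prodExp_iff.2 ⟨s, rfl⟩⟩, ?_⟩
    · obtain ⟨a, rfl⟩ := mem_range_prodExp_iff.1 (hS hy)
      exact hK.2 (hs.1 hy)
    · rintro c ⟨hc, hcr⟩
      obtain ⟨c', rfl⟩ := mem_range_prodExp_iff.1 hcr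
      exact hK.2 (hs.2 fun a ha => hK.1 (hc ha))
  map_unit := by
    funext ψ
    rw [prodExp_apply]
    exact congrArg _ (integral_const_L1 1)

theorem isConditionalRieszTriple_prodL1 : IsConditionalRieszTriple ProdL1 prodUnit prodExp :=
  ⟨isDedekindCompleteRieszSpace_prodL1, isWeakOrderUnit_prodUnit,
    isConditionalExpectation_prodExp⟩

/-! ### Universal completion and natural domain -/

theorem mem_Lp_one_of_integrable {u : L0} (h : Integrable u) : u ∈ Lp ℝ 1 (volume : Measure I) :=
  Lp.mem_Lp_iff_memLp.2 (memLp_one_iff_integrable.2 h)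

/-- The truncation of a positive measurable function at a constant. -/
theorem exists_L1_eq_inf_const {u : L0} (h : 0 ≤ u) (c : ℝ) (hc : 0 ≤ c) :
    ∃ x : L1, (x : L0) = u ⊓ AEEqFun.const I c ∧ 0 ≤ x ∧ x =ᵐ[volume] fun t => min (u t) c := by
  have hae : ⇑(u ⊓ AEEqFun.const I c) =ᵐ[volume] fun t => min (u t) c := by
    filter_upwards [AEEqFun.coeFn_inf u (AEEqFun.const I c), AEEqFun.coeFn_const I c] with t h1 h2
    rw [h1, h2]
    rfl
  have hu : ∀ᵐ t, 0 ≤ u t := by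
    filter_upwards [AEEqFun.coeFn_le.2 h, AEEqFun.coeFn_zero (α := I) (β := ℝ)] with t h1 h2
    rw [h2] at h1
    exact h1
  have hint : Integrable (u ⊓ AEEqFun.const I c : L0) := by
    refine Integrable.of_bound (AEEqFun.aestronglyMeasurable _) c ?_
    filter_upwards [hae, hu] with t h1 h2
    rw [h1, Real.norm_eq_abs, abs_of_nonneg (le_min h2 hc)]
    exact min_le_right _ _
  refine ⟨⟨_, mem_Lp_one_of_integrable hint⟩, rfl, ?_, hae⟩
  rw [← Lp.coeFn_nonneg]
  filter_upwards [hae, hu] with t h1 h2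
  exact (le_min h2 hc).trans_eq h1.symm

theorem isUniversalCompletion_prodIncl : IsUniversalCompletion prodIncl where
  injective f g h := by
    funext ψ
    exact Subtype.ext (congrFun h ψ)
  map_sup _ _ := rfl
  complete := isDedekindCompleteRieszSpace_prodL0
  laterally_complete S hS hpos hd := by
    choose s hs using fun ψ => exists_isLUB_L0_of_pairwise_disjoint (hS.image (Function.eval ψ))
      (by rintro _ ⟨x, hx, rfl⟩; exact hpos x hx ψ)
      (by
        rintro _ ⟨x, hx, rfl⟩ _ ⟨y, hy, rfl⟩ hxy
        exact congrFun (hd hx hy fun h => hxy (by rw [h])) ψ)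
    exact ⟨s, isLUB_pi.2 hs⟩
  order_dense u hu := by
    classical
    obtain ⟨hu0, ψ, hψ⟩ := Pi.lt_def.1 hu
    -- In a coordinate where `u` is nonzero, `u ψ ⊓ 1` is integrable and nonzero; placed alone in
    -- that coordinate it lies below `u`.
    obtain ⟨x, hx, hx0, hxt⟩ := exists_L1_eq_inf_const hψ.le 1 zero_le_one
    have hxne : x ≠ 0 := by
      rintro rfl
      refine hψ.ne' (AEEqFun.ext ?_)
      filter_upwards [hxt, Lp.coeFn_zero ℝ 1 (volume : Measure I),
        AEEqFun.coeFn_zero (α := I) (β := ℝ)] with t h1 h2 h3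
      rw [h2, Pi.zero_apply] at h1
      change u ψ t = (0 : L0) t
      rw [h3]
      rcases min_choice (u ψ t) 1 with h4 | h4
      · rw [h4] at h1; exact h1.symm
      · rw [h4] at h1; norm_num at h1
    refine ⟨Pi.single ψ x, ?_, fun χ => ?_⟩
    · exact lt_of_le_of_ne (Pi.single_nonneg.2 hx0) fun h => hxne (Pi.single_eq_zero_iff.1 h.symm)
    · by_cases hχ : χ = ψ
      · subst hχ
        rw [prodIncl_apply, Pi.single_eq_same, hx]
        exact inf_le_left
      · rw [prodIncl_apply, Pi.single_eq_of_ne hχ]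
        exact hu0 χ

/-- By Fatou's lemma, a limit of positive integrable functions with bounded integrals is
integrable. -/
theorem integrable_of_tendsto_of_integral_le {g : ℕ → L1} {s : L0} {M : ℝ}
    (hlim : ∀ᵐ t, Tendsto (fun n => g n t) atTop (𝓝 (s t))) (hg0 : ∀ n, 0 ≤ g n)
    (hM : ∀ n, ∫ t, g n t ≤ M) : Integrable s := by
  refine ⟨s.aestronglyMeasurable, lt_of_le_of_lt ?_ (ENNReal.ofReal_lt_top (r := M))⟩
  have h1 : ∀ n, ∫⁻ t, ‖g n t‖ₑ ≤ ENNReal.ofReal M := by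
    intro n
    rw [← ofReal_integral_norm_eq_lintegral_enorm (L1.integrable_coeFn (g n))]
    refine ENNReal.ofReal_le_ofReal ((integral_congr_ae ?_).trans_le (hM n))
    filter_upwards [(Lp.coeFn_nonneg _).2 (hg0 n)] with t ht
    exact abs_of_nonneg ht
  calc ∫⁻ t, ‖s t‖ₑ = ∫⁻ t, liminf (fun n => ‖g n t‖ₑ) atTop := by
        refine lintegral_congr_ae ?_
        filter_upwards [hlim] with t ht
        exact ht.enorm.liminf_eq.symm
    _ ≤ liminf (fun n => ∫⁻ t, ‖g n t‖ₑ) atTop :=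
        lintegral_liminf_le' fun n => (g n : L0).aestronglyMeasurable.enorm
    _ ≤ liminf (fun _ : ℕ => ENNReal.ofReal M) atTop :=
        liminf_le_liminf (Eventually.of_forall h1)
    _ = ENNReal.ofReal M := liminf_const _

/-- In each coordinate an increasing sequence from `D` reaches `|u|`, and its integrals are bounded
because an order bound on constants is a bound on numbers; Fatou then makes `u` coordinatewise
integrable. -/
theorem naturalDomain_prodExp : naturalDomain prodIncl prodExp = Set.range prodIncl := by
  ext u
  constructor
  · rintro ⟨D, hD, hpos, hd, hlub, B, hB⟩
    have hint : ∀ ψ, Integrable (u ψ) := by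
      intro ψ
      obtain ⟨g, hg, hgD, hgb⟩ := exists_monotone_seq_mem_upperBounds
        (hD.image (Function.eval ψ)) (by
          rintro _ ⟨x, hx, rfl⟩ _ ⟨y, hy, rfl⟩
          obtain ⟨z, hz, h1, h2⟩ := hd x hx y hy
          exact ⟨_, ⟨z, hz, rfl⟩, h1 ψ, h2 ψ⟩)
      have hlubψ := isLUB_pi.1 hlub ψ
      have hgu : ∀ n, (g n : L0) ≤ |u| ψ := fun n => by
        obtain ⟨x, hx, hxg⟩ := hgD n
        exact hlubψ.1 ⟨_, ⟨x, hx, rfl⟩, congrArg Subtype.val hxg⟩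
      have hbdd : ∀ᵐ t, ∀ n, g n t ≤ (|u| ψ : L0) t :=
        ae_all_iff.2 fun n => AEEqFun.coeFn_le.2 (hgu n)
      obtain ⟨s, hs, hst⟩ := exists_isLUB_range_of_ae_bddAbove (fun n => (g n : L0)) <| by
        filter_upwards [hbdd] with t ht
        exact ⟨_, by rintro _ ⟨n, rfl⟩; exact ht n⟩
      have hsu : s = |u| ψ := by
        refine le_antisymm (hs.2 (by rintro _ ⟨n, rfl⟩; exact hgu n)) (hlubψ.2 ?_)
        rintro _ ⟨_, ⟨x, hx, rfl⟩, rfl⟩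
        exact hgb s (fun n => hs.1 ⟨n, rfl⟩) _ ⟨x, hx, rfl⟩
      have hmono : ∀ᵐ t, Monotone fun n => g n t := by
        have : ∀ᵐ t, ∀ n, g n t ≤ g (n + 1) t :=
          ae_all_iff.2 fun n => (Lp.coeFn_le _ _).2 (hg n.le_succ)
        filter_upwards [this] with t ht
        exact monotone_nat_of_le_succ ht
      have hg0 : ∀ n, 0 ≤ g n := fun n => by
        obtain ⟨x, hx, hxg⟩ := hgD n
        rw [← hxg]
        exact hpos x hx ψ
      obtain ⟨M, hM⟩ : ∃ M : ℝ, ∀ n, ∫ t, g n t ≤ M := by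
        have : ∀ᵐ t, ∀ n, ∫ t, g n t ≤ B ψ t := ae_all_iff.2 fun n => by
          obtain ⟨x, hx, hxg⟩ := hgD n
          have h1 := AEEqFun.coeFn_le.2 (hB ⟨_, ⟨x, hx, rfl⟩, rfl⟩ ψ)
          rw [prodIncl_apply, prodExp_apply, show x ψ = g n from hxg] at h1
          filter_upwards [h1, Lp.coeFn_const 1 (volume : Measure I) (∫ t, g n t)] with t h2 h3
          rw [h3] at h2
          exact h2
        -- `B ψ` is only a measurable function, but its value at one good point bounds all the
        -- constants at once.
        obtain ⟨t, ht⟩ := this.exists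
        exact ⟨_, ht⟩
      have hlim : ∀ᵐ t, Tendsto (fun n => g n t) atTop (𝓝 (s t)) := by
        filter_upwards [hmono, hbdd, hst] with t h1 h2 h3
        rw [h3]
        exact tendsto_atTop_ciSup h1 ⟨_, by rintro _ ⟨n, rfl⟩; exact h2 n⟩
      have hs_int : Integrable s :=
        integrable_of_tendsto_of_integral_le hlim hg0 hM
      rw [hsu] at hs_int
      refine hs_int.mono (u ψ).aestronglyMeasurable ?_
      filter_upwards [AEEqFun.coeFn_abs (u ψ)] with t ht
      change _ ≤ ‖(|u ψ| : L0) t‖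
      rw [ht]
      simp
    exact ⟨fun ψ => ⟨u ψ, mem_Lp_one_of_integrable (hint ψ)⟩, rfl⟩
  · rintro ⟨x, rfl⟩
    refine ⟨{|x|}, Set.singleton_nonempty _, ?_, directedOn_singleton _, ?_, ?_⟩
    · rintro _ rfl
      exact abs_nonneg x
    · rw [Set.image_singleton]
      exact isLUB_singleton
    · rw [Set.image_singleton, Set.image_singleton]
      exact bddAbove_singleton

end ConditionalRieszTriple

/-! ### Integrable functions with divergent `φ`-integral -/

section DeLaValleePoussin

theorem tendsto_setIntegral_le_abs (X : L1) :
    Tendsto (fun n : ℕ => ∫ t in {t | (n : ℝ) ≤ |X t|}, |X t|) atTop (𝓝 0) := by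
  have hX : Measurable fun t => |X t| := continuous_abs.measurable.comp (X : L0).measurable
  have h := tendsto_setIntegral_of_antitone (μ := (volume : Measure I)) (f := fun t => |X t|)
    (s := fun n : ℕ => {t | (n : ℝ) ≤ |X t|}) (fun n => measurableSet_le measurable_const hX)
    (fun m n hmn t (ht : (n : ℝ) ≤ |X t|) => (Nat.cast_le.2 hmn).trans ht)
    ⟨0, (L1.integrable_coeFn X).abs.integrableOn⟩
  have h1 : ⋂ n : ℕ, {t | (n : ℝ) ≤ |X t|} = ∅ := by
    refine Set.eq_empty_of_forall_notMem fun t ht => ?_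
    obtain ⟨n, hn⟩ := exists_nat_gt |X t|
    exact absurd (Set.mem_iInter.1 ht n) (not_le.2 hn)
  rwa [h1, Measure.restrict_empty, integral_zero_measure] at h

/-- Take `X = ∑ x n · 1_[0, a n]` with `φ y ≥ 4 ^ n * y` for `y ≥ x n`, and `a n` chosen so that the
`n`-th step has integral `2⁻ⁿ`. Then `X` is integrable, while `X ≥ x n` on `[0, a n]` gives `∫ φ(X)
≥ 4 ^ n * 2⁻ⁿ = 2 ^ n` for every `n`. -/
theorem ConvexTestFunction.exists_L1_lintegral_eq_top (φ : ConvexTestFunction) :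
    ∃ X : L1, ∫⁻ t, (φ ‖X t‖₊ : ℝ≥0∞) = ⊤ := by
  -- The requirement `1 ≤ x` keeps `a n = 2⁻ⁿ / x n` inside `[0,1]`.
  have hx : ∀ n : ℕ, ∃ x : ℝ≥0, 1 ≤ x ∧ ∀ y ≥ x, 4 ^ n * y ≤ φ y := by
    intro n
    obtain ⟨x, hx⟩ := eventually_atTop.1
      ((φ.2.2.eventually_ge_atTop (4 ^ n)).and (eventually_ge_atTop 1))
    refine ⟨max x 1, le_max_right _ _, fun y hy => ?_⟩
    obtain ⟨h1, h2⟩ := hx y ((le_max_left _ _).trans hy)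
    exact (le_div_iff₀ (zero_lt_one.trans_le h2)).1 h1
  choose x hx1 hxφ using hx
  have ha : ∀ n, ((2⁻¹ ^ n * (x n)⁻¹ : ℝ≥0) : ℝ) ∈ I := fun n => by
    refine ⟨NNReal.coe_nonneg _, ?_⟩
    have : (2⁻¹ ^ n * (x n)⁻¹ : ℝ≥0) ≤ 1 :=
      mul_le_one' (pow_le_one' (by norm_num) n) (inv_le_one_of_one_le₀ (hx1 n))
    exact_mod_cast this
  let a : ℕ → I := fun n => ⟨_, ha n⟩
  have hvol : ∀ n, (x n : ℝ≥0∞) * volume (Set.Iic (a n)) = 2⁻¹ ^ n := by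
    intro n
    rw [unitInterval.volume_Iic]
    change (x n : ℝ≥0∞) * ENNReal.ofReal ((2⁻¹ ^ n * (x n)⁻¹ : ℝ≥0) : ℝ) = _
    rw [ENNReal.ofReal_coe_nnreal, ← ENNReal.coe_mul, mul_left_comm,
      mul_inv_cancel₀ (zero_lt_one.trans_le (hx1 n)).ne', mul_one, ENNReal.coe_pow,
      ENNReal.coe_inv two_ne_zero]
    rfl
  let F : I → ℝ≥0∞ := fun t => ∑' n, (Set.Iic (a n)).indicator (fun _ => (x n : ℝ≥0∞)) t
  have hFm : Measurable F :=
    Measurable.tsum fun n => measurable_const.indicator measurableSet_Iic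
  have hF : ∫⁻ t, F t ≠ ⊤ := by
    have : ∫⁻ t, F t = ∑' n : ℕ, (2⁻¹ : ℝ≥0∞) ^ n := by
      rw [lintegral_tsum fun n => (measurable_const.indicator measurableSet_Iic).aemeasurable]
      refine tsum_congr fun n => ?_
      rw [lintegral_indicator_const measurableSet_Iic, hvol]
    rw [this, ENNReal.tsum_geometric]
    simp
  have hint : Integrable fun t => (F t).toReal :=
    integrable_toReal_of_lintegral_ne_top hFm.aemeasurable hF
  refine ⟨hint.toL1 _, ?_⟩
  have hle : ∀ n : ℕ, (2 : ℝ≥0∞) ^ n ≤ ∫⁻ t, (φ ‖hint.toL1 _ t‖₊ : ℝ≥0∞) := by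
    intro n
    calc (2 : ℝ≥0∞) ^ n = 4 ^ n * 2⁻¹ ^ n := by
          rw [← mul_pow]
          congr 1
          rw [show (4 : ℝ≥0∞) = 2 * 2 by norm_num, mul_assoc,
            ENNReal.mul_inv_cancel two_ne_zero ENNReal.ofNat_ne_top, mul_one]
      _ = ∫⁻ t in Set.Iic (a n), ((4 ^ n * x n : ℝ≥0) : ℝ≥0∞) := by
          rw [setLIntegral_const, ENNReal.coe_mul, mul_assoc, hvol]
          norm_num
      _ ≤ ∫⁻ t in Set.Iic (a n), (φ ‖hint.toL1 _ t‖₊ : ℝ≥0∞) := by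
          refine lintegral_mono_ae ?_
          filter_upwards [ae_restrict_mem measurableSet_Iic,
            ae_restrict_of_ae (ae_lt_top hFm hF), ae_restrict_of_ae hint.coeFn_toL1]
            with t h1 h2 h3
          have h4 : ‖hint.toL1 _ t‖₊ = (F t).toNNReal := by
            rw [h3]
            ext
            rw [coe_nnnorm, Real.norm_of_nonneg ENNReal.toReal_nonneg, ENNReal.coe_toNNReal_eq_toReal]
          have h5 : x n ≤ (F t).toNNReal := by
            rw [← ENNReal.coe_le_coe, ENNReal.coe_toNNReal h2.ne]
            refine le_trans ?_ (ENNReal.le_tsum n)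
            rw [Set.indicator_of_mem h1]
          rw [h4, ENNReal.coe_le_coe]
          exact (mul_le_mul_right h5 _).trans (hxφ n _ h5)
      _ ≤ _ := setLIntegral_le_lintegral _ _
  refine ENNReal.eq_top_of_forall_nnreal_le fun r => ?_
  obtain ⟨n, hn⟩ := pow_unbounded_of_one_lt r (one_lt_two (α := ℝ≥0))
  refine le_trans ?_ (hle n)
  exact_mod_cast hn.le

/-! ### Band projections and `T`-uniformity of the spike family -/

theorem isBandProj_pi_iff {ι : Type*} {E : ι → Type*} [∀ i, AddCommGroup (E i)]
    [∀ i, Lattice (E i)] {u v w : ∀ i, E i} :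
    IsBandProj u v w ↔ ∀ i, IsBandProj (u i) (v i) (w i) := by
  unfold IsBandProj
  rw [isLUB_pi]
  refine forall_congr' fun i => ?_
  rw [← Set.range_comp]
  rfl

theorem IsDedekindCompleteRieszSpace.exists_isBandProj {E : Type*} [AddCommGroup E] [Lattice E]
    [Module ℝ E] (hE : IsDedekindCompleteRieszSpace E) (u v : E) : ∃ w, IsBandProj u v w :=
  hE.exists_isLUB _ (Set.range_nonempty _) ⟨v, by rintro _ ⟨n, rfl⟩; exact inf_le_left⟩

theorem IsBandProj.nonneg {E : Type*} [AddCommGroup E] [Lattice E]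
    {u v w : E} (h : IsBandProj u v w) (hv : 0 ≤ v) : 0 ≤ w :=
  h.1 ⟨0, by simp [hv]⟩

theorem IsBandProj.mono {E : Type*} [AddCommGroup E] [Lattice E]
    [IsOrderedAddMonoid E] {u u' v w w' : E} (h : IsBandProj u v w) (h' : IsBandProj u' v w')
    (hu : u ≤ u') : w ≤ w' := by
  refine h.2 ?_
  rintro _ ⟨n, rfl⟩
  exact (inf_le_inf_left _ (nsmul_le_nsmul_right hu n)).trans (h'.1 ⟨n, rfl⟩)

theorem IsBandProj.eq_zero {E : Type*} [AddCommGroup E] [Lattice E]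
    {u w : E} (h : IsBandProj u 0 w) : w = 0 := by
  refine le_antisymm (h.2 ?_) (h.nonneg le_rfl)
  rintro _ ⟨n, rfl⟩
  exact inf_le_left

/-- Where `|X| < c` the generator `(|X| - c)⁺` vanishes, so the projection of `|X|` is supported in
`{c ≤ |X|}`; this links abstract tails to classical ones. -/
theorem IsBandProj.integral_le {X w : L1} {c : ℝ}
    (h : IsBandProj ((|X| - c • Lp.const 1 volume 1) ⊔ 0) |X| w) :
    ∫ t, w t ≤ ∫ t in {t | c ≤ |X t|}, |X t| := by
  have hm : MeasurableSet {t | c ≤ |X t|} :=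
    measurableSet_le measurable_const (continuous_abs.measurable.comp (X : L0).measurable)
  have hint : Integrable ({t | c ≤ |X t|}.indicator fun t => |X t|) :=
    (L1.integrable_coeFn X).abs.indicator hm
  have hle : w ≤ hint.toL1 _ := by
    refine h.2 ?_
    rintro _ ⟨n, rfl⟩
    dsimp only
    rw [← Nat.cast_smul_eq_nsmul ℝ, ← Lp.coeFn_le]
    filter_upwards [hint.coeFn_toL1, Lp.coeFn_abs X,
      Lp.coeFn_inf |X| ((n : ℝ) • ((|X| - c • Lp.const 1 volume 1) ⊔ 0)),
      Lp.coeFn_smul (n : ℝ) ((|X| - c • Lp.const 1 volume 1) ⊔ 0),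
      Lp.coeFn_sup (|X| - c • Lp.const 1 volume 1) 0, Lp.coeFn_sub |X| (c • Lp.const 1 volume 1),
      Lp.coeFn_smul c (Lp.const 1 (volume : Measure I) (1 : ℝ)),
      Lp.coeFn_const 1 (volume : Measure I) (1 : ℝ), Lp.coeFn_zero ℝ 1 (volume : Measure I)]
      with t h1 h2 h3 h4 h5 h6 h7 h8 h9
    rw [h1, h3, Pi.inf_apply, h4, Pi.smul_apply, h5, Pi.sup_apply, h6, Pi.sub_apply, h7,
      Pi.smul_apply, h8, h9, h2]
    by_cases hc : c ≤ |X t|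
    · rw [Set.indicator_of_mem (s := {t | c ≤ |X t|}) hc]
      exact inf_le_left
    · rw [Set.indicator_of_notMem (s := {t | c ≤ |X t|}) hc]
      refine inf_le_right.trans_eq ?_
      have h10 : |X t| - c • Function.const I (1 : ℝ) t ≤ (0 : I → ℝ) t := by
        simpa using (not_le.1 hc).le
      rw [sup_eq_right.2 h10]
      simp
  refine (integral_L1_mono hle).trans_eq ?_
  rw [integral_congr_ae hint.coeFn_toL1, integral_indicator hm]

theorem smul_const_one (c : ℝ) :
    c • Lp.const 1 (volume : Measure I) (1 : ℝ) = Lp.const 1 volume c := by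
  have := (Lp.constₗ 1 (volume : Measure I) ℝ (E := ℝ)).map_smul c 1
  rw [smul_eq_mul, mul_one] at this
  exact this.symm

theorem spikeFamily_same (X : ConvexTestFunction → L1) (φ : ConvexTestFunction) :
    spikeFamily X φ φ = X φ := if_pos rfl

theorem spikeFamily_of_ne (X : ConvexTestFunction → L1) {φ ψ : ConvexTestFunction} (h : ψ ≠ φ) :
    spikeFamily X φ ψ = 0 := if_neg h

theorem isBandProj_tail_iff {Y W : ProdL1} {c : ℝ} :
    IsBandProj ((|Y| - c • prodUnit) ⊔ 0) |Y| W ↔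
      ∀ ψ, IsBandProj ((|Y ψ| - c • Lp.const 1 volume 1) ⊔ 0) |Y ψ| (W ψ) :=
  isBandProj_pi_iff

/-- In coordinate `ψ` only the member with index `ψ` has a tail that can be nonzero, so the supremum
is attained there and equals the expected tail of `X ψ`. These suprema decrease in `c` and serve as
their own dominating net. -/
theorem isTUniform_spikeFamily (X : ConvexTestFunction → L1) :
    IsTUniform prodUnit prodExp (spikeFamily X) := by
  have hE : IsDedekindCompleteRieszSpace L1 :=
    ⟨fun _ _ z h => add_le_add_left h z, fun r x hr hx => smul_nonneg_L0 r x hr hx,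
      fun _ => exists_isLUB_Lp_one⟩
  choose w hw using fun (c : ℝ) (ψ : ConvexTestFunction) =>
    hE.exists_isBandProj ((|X ψ| - c • Lp.const 1 volume 1) ⊔ 0) |X ψ|
  have hw0 : ∀ c ψ, 0 ≤ w c ψ := fun c ψ => (hw c ψ).nonneg (abs_nonneg _)
  let s : ℝ → ProdL1 := fun c ψ => Lp.const 1 volume (∫ t, w c ψ t)
  have hs0 : ∀ c, 0 ≤ s c := fun c => prodExp_nonneg (x := w c) (hw0 c)
  have hs : Antitone s := by
    intro c d hcd ψ
    refine const_le_const_iff.2 (integral_L1_mono ((hw d ψ).mono (hw c ψ) ?_))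
    rw [smul_const_one, smul_const_one]
    exact sup_le_sup_right (sub_le_sub_left (const_le_const_iff.2 hcd) _) _
  refine ⟨s, fun c hc => isLUB_pi.2 fun ψ => IsGreatest.isLUB ⟨?_, ?_⟩, s '' Set.Ioi 0,
    ⟨_, 1, Set.mem_Ioi.2 zero_lt_one, rfl⟩, ?_, ⟨?_, fun b hb ψ => ?_⟩, ?_⟩
  · obtain ⟨W, hW⟩ := isDedekindCompleteRieszSpace_prodL1.exists_isBandProj
      ((|spikeFamily X ψ| - c • prodUnit) ⊔ 0) |spikeFamily X ψ|
    have h := isBandProj_tail_iff.1 hW ψ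
    rw [spikeFamily_same] at h
    have h1 : prodExp W ψ = s c ψ := by
      rw [prodExp_apply, h.unique (hw c ψ)]
    exact ⟨prodExp W, ⟨ψ, W, hW, rfl⟩, h1⟩
  · rintro _ ⟨_, ⟨χ, W, hW, rfl⟩, rfl⟩
    refine const_le_const_iff.2 (integral_L1_mono ?_)
    have h := isBandProj_tail_iff.1 hW ψ
    by_cases hχ : ψ = χ
    · subst hχ
      rw [spikeFamily_same] at h
      exact (h.unique (hw c ψ)).le
    · rw [spikeFamily_of_ne X hχ, abs_zero] at h
      rw [h.eq_zero]
      exact hw0 c ψ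
  · rintro _ ⟨c, hc, rfl⟩ _ ⟨d, -, rfl⟩
    exact ⟨_, ⟨max c d, Set.mem_Ioi.2 (lt_max_of_lt_left hc), rfl⟩, hs (le_max_left c d),
      hs (le_max_right c d)⟩
  · rintro _ ⟨c, -, rfl⟩
    exact hs0 c
  -- The thresholds are `n + 1` because the net is indexed by `c > 0`.
  · refine le_zero_of_le_const_of_tendsto (fun n => ?_)
      ((tendsto_add_atTop_iff_nat 1).2 (tendsto_setIntegral_le_abs (X ψ)))
    exact (hb ⟨((n + 1 : ℕ) : ℝ), Set.mem_Ioi.2 (Nat.cast_pos.2 n.succ_pos), rfl⟩ ψ).trans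
      (const_le_const_iff.2 (hw _ ψ).integral_le)
  · rintro _ ⟨c, -, rfl⟩
    filter_upwards [eventually_ge_atTop c] with d hd
    rw [sub_zero, abs_of_nonneg (hs0 d)]
    exact hs hd

/-! ### Failure of every test function on the diagonal -/

theorem ConvexTestFunction.coeFn_compAbs_spikeFamily (φ : ConvexTestFunction)
    (X : ConvexTestFunction → L1) :
    φ.compAbs (prodIncl (spikeFamily X φ)) φ =ᵐ[volume] fun t => (φ ‖X φ t‖₊ : ℝ) := by
  have h := AEEqFun.coeFn_compMeasurable (fun r : ℝ => (φ ‖r‖₊ : ℝ))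
    (measurable_coe_nnreal_real.comp (φ.measurable.comp measurable_nnnorm))
    (prodIncl (spikeFamily X φ) φ)
  refine h.trans (Eventually.of_forall fun t => ?_)
  rw [prodIncl_apply, spikeFamily_same]
  rfl

theorem ConvexTestFunction.compAbs_nonneg (φ : ConvexTestFunction) (z : ProdL0) :
    0 ≤ φ.compAbs z := by
  intro ψ
  rw [← AEEqFun.coeFn_le]
  filter_upwards [AEEqFun.coeFn_compMeasurable (fun r : ℝ => (φ ‖r‖₊ : ℝ))
    (measurable_coe_nnreal_real.comp (φ.measurable.comp measurable_nnnorm)) (z ψ),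
    AEEqFun.coeFn_zero (α := I) (β := ℝ)] with t h1 h2
  refine h2.trans_le (le_of_le_of_eq ?_ h1.symm)
  exact NNReal.coe_nonneg _

theorem not_integrable_compAbs_spikeFamily {X : ConvexTestFunction → L1} {φ : ConvexTestFunction}
    (hX : ∫⁻ t, (φ ‖X φ t‖₊ : ℝ≥0∞) = ⊤) :
    ¬ Integrable (φ.compAbs (prodIncl (spikeFamily X φ)) φ) := by
  intro h
  refine h.2.ne ?_
  rw [← hX]
  refine lintegral_congr_ae ?_
  filter_upwards [φ.coeFn_compAbs_spikeFamily X] with t ht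
  rw [ht]
  simp

theorem not_hasSupInNaturalDomain_spikeFamily {X : ConvexTestFunction → L1}
    {φ : ConvexTestFunction} (hX : ∫⁻ t, (φ ‖X φ t‖₊ : ℝ≥0∞) = ⊤) :
    ¬ HasSupInNaturalDomain prodIncl prodExp
      fun χ => φ.compAbs (prodIncl (spikeFamily X χ)) := by
  rintro ⟨W, hW, -⟩
  refine not_integrable_compAbs_spikeFamily hX ?_
  have h : (W φ φ : L0) = φ.compAbs (prodIncl (spikeFamily X φ)) φ := congrFun (hW φ) φ
  exact h ▸ L1.integrable_coeFn (W φ φ)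

/-- The truncations of `φ(|X φ|)` at `n`, placed in coordinate `φ`, are admissible elements below
`φ(|Y^φ|)`. A supremum `s` would bound their integrals by `∫ s φ`, and Fatou would make `φ(|X φ|)`
integrable. -/
theorem not_hasFiniteSup_spikeFamily {X : ConvexTestFunction → L1}
    {φ : ConvexTestFunction} (hX : ∫⁻ t, (φ ‖X φ t‖₊ : ℝ≥0∞) = ⊤) :
    ¬ HasFiniteSup prodIncl prodExp fun χ => φ.compAbs (prodIncl (spikeFamily X χ)) := by
  classical
  rintro ⟨s, hs⟩
  have hz0 := φ.compAbs_nonneg (prodIncl (spikeFamily X φ))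
  set z : ProdL0 := φ.compAbs (prodIncl (spikeFamily X φ)) with hz
  choose x hx hx0 hxt using fun n : ℕ => exists_L1_eq_inf_const (hz0 φ) n n.cast_nonneg
  have hle : ∀ n, Lp.const 1 volume (∫ t, x n t) ≤ s φ := by
    intro n
    have h : prodExp (Pi.single φ (x n)) ≤ s := by
      refine hs.1 ⟨φ, Pi.single φ (x n), Pi.single_nonneg.2 (hx0 n), fun ψ => ?_, rfl⟩
      by_cases hψ : ψ = φ
      · subst hψ
        rw [prodIncl_apply, Pi.single_eq_same, hx]
        exact inf_le_left
      · rw [prodIncl_apply, Pi.single_eq_of_ne hψ]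
        exact hz0 ψ
    have h1 := h φ
    rwa [prodExp_apply, Pi.single_eq_same] at h1
  have hM : ∀ n, ∫ t, x n t ≤ ∫ t, s φ t := fun n => by
    have := integral_L1_mono (hle n)
    rwa [integral_const_L1] at this
  refine not_integrable_compAbs_spikeFamily hX
    (integrable_of_tendsto_of_integral_le ?_ hx0 hM)
  filter_upwards [ae_all_iff.2 hxt] with t ht
  refine tendsto_const_nhds.congr' ?_
  obtain ⟨N, hN⟩ := exists_nat_ge (z φ t)
  filter_upwards [eventually_ge_atTop N] with n hn
  rw [ht n]
  exact (min_eq_left (hN.trans (Nat.cast_le.2 hn))).symm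

end DeLaValleePoussin

theorem mainTheorem5 :
    -- the setting: `(E^A, e, T)` is a conditional Riesz triple which is its own natural domain
    IsConditionalRieszTriple ProdL1 prodUnit prodExp ∧
    IsUniversalCompletion prodIncl ∧
    naturalDomain prodIncl prodExp = Set.range prodIncl ∧
    -- functions `X_φ` as required exist
    (∀ φ : ConvexTestFunction, ∃ X : L1,
      Tendsto (fun n : ℕ => ∫ t in {t | (n : ℝ) ≤ |X t|}, |X t|) atTop (𝓝 0) ∧
      ∫⁻ t, (φ ‖X t‖₊ : ℝ≥0∞) = ⊤) ∧
    -- for every choice of them the family `(Y^φ)` is `T`-uniform and admits no test function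
    (∀ X : ConvexTestFunction → L1, (∀ φ : ConvexTestFunction, ∫⁻ t, (φ ‖X φ t‖₊ : ℝ≥0∞) = ⊤) →
      IsTUniform prodUnit prodExp (spikeFamily X) ∧
      (¬ ∃ φ : ConvexTestFunction, HasSupInNaturalDomain prodIncl prodExp
        fun χ => φ.compAbs (prodIncl (spikeFamily X χ))) ∧
      (¬ ∃ φ : ConvexTestFunction, HasFiniteSup prodIncl prodExp
        fun χ => φ.compAbs (prodIncl (spikeFamily X χ)))) ∧
    -- hence the necessity direction of the criterion of de la Vallée Poussin fails
    ¬ ∀ Y : ConvexTestFunction → ProdL1, IsTUniform prodUnit prodExp Y →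
      ∃ φ : ConvexTestFunction, HasFiniteSup prodIncl prodExp
        fun χ => φ.compAbs (prodIncl (Y χ)) := by
  have hcounter : ∀ X : ConvexTestFunction → L1,
      (∀ φ : ConvexTestFunction, ∫⁻ t, (φ ‖X φ t‖₊ : ℝ≥0∞) = ⊤) →
      ¬ ∃ φ : ConvexTestFunction, HasFiniteSup prodIncl prodExp
        fun χ => φ.compAbs (prodIncl (spikeFamily X χ)) :=
    fun X hX ⟨φ, h⟩ => not_hasFiniteSup_spikeFamily (hX φ) h
  refine ⟨isConditionalRieszTriple_prodL1, isUniversalCompletion_prodIncl, naturalDomain_prodExp,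
    fun φ => ?_, fun X hX => ⟨isTUniform_spikeFamily X, ?_, hcounter X hX⟩, fun h => ?_⟩
  · obtain ⟨X, hX⟩ := φ.exists_L1_lintegral_eq_top
    exact ⟨X, tendsto_setIntegral_le_abs X, hX⟩
  · rintro ⟨φ, h⟩
    exact not_hasSupInNaturalDomain_spikeFamily (hX φ) h
  · choose X hX using ConvexTestFunction.exists_L1_lintegral_eq_top
    exact hcounter X hX (h _ (isTUniform_spikeFamily X))
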